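/- Let $\mathcal U,\mathcal Y$ be complex Hilbert spaces, let $\mathbb C^+=\{\mu\in\mathbb C:\operatorname{Re}\mu>0\}$, and let $\varphi:\mathbb C^+\to\mathcal B(\mathcal U,\mathcal Y)$ be a Schur function, i.e. $\varphi$ is holomorphic and its values are contractions. Let $\mathcal H_o$ be the Hilbert space of $\mathcal Y$-valued functions on $\mathbb C^+$ with reproducing kernel $$K_o(\mu,\lambda)=\frac{1_{\mathcal Y}-\varphi(\mu)\varphi(\lambda)^*}{\mu+\overline\lambda},\qquad e_o(\lambda)^*y:=K_o(\cdot,\lambda)y .$$ The observable co-energy-preserving model $S_o=\left[\begin{smallmatrix}A\&B\\ C\&D\end{smallmatrix}\right]_o:\mathcal H_o\oplus\mathcal U\supset\operatorname{dom}(S_o)\to\mathcal H_o\oplus\mathcal Y$ is the adjoint of the closed operator obtained by linearity and limit-closure from $$(e_o(\lambda)^*y,\;y)\mapsto(\overline\lambda\, e_o(\lambda)^*y,\;\varphi(\lambda)^*y),\qquad \lambda\in\mathbb C^+,\ y\in\mathcal Y .$$ Its main operator $A_o$ and observation operator $C_o$ are given on $\operatorname{dom}(A_o)=\operatorname{dom}(C_o)=\{x\in\mathcal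 H_o:(x,0)\in\operatorname{dom}(S_o)\}$ by $(A_ox,\,C_ox)=S_o(x,0)$. The resolvent set of a closed operator $A$ consists of all $\alpha\in\mathbb C$ such that $\alpha-A$ maps $\operatorname{dom}(A)$ one-to-one onto the space. For $\beta\in\mathbb C^+$, let $\mathcal H_{o,-1}$ be the completion of $\mathcal H_o$ in the norm $\|x\|_{-1}=\|(\beta-A_o)^{-1}x\|$, let $A_o|_{\mathcal H_o}:\mathcal H_o\to\mathcal H_{o,-1}$ be the continuous extension of $A_o$, and let the control operator $B_o:\mathcal U\to\mathcal H_{o,-1}$ be the bounded operator such that for all $(x,u)\in\operatorname{dom}(S_o)$ the first component of $S_o(x,u)$ equals $A_o|_{\mathcal H_o}x+B_ou$ in $\mathcal H_{o,-1}$. Then the following hold (difference quotients at $\mu=\alpha$ are understood as their limits for $\mu\to\alpha$, which exist). 1. $\operatorname{dom}(A_o)=\{x\in\mathcal H_o:\ \exists y\in\mathcal Y,\ (\mu\mapsto\mu x(\mu)-y)\in\mathcal H_o\}$, and for every $x\in\operatorname{dom}(A_o)$ the limit $\lim_{\operatorname{Re}\eta\to\infty}\eta x(\eta)$ exists in $\mathcal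 Y$ and $$(A_ox)(\mu)=\mu x(\mu)-\lim_{\operatorname{Re}\eta\to\infty}\eta x(\eta)\quad(\mu\in\mathbb C^+),\qquad C_ox=\lim_{\operatorname{Re}\eta\to\infty}\eta x(\eta).$$ 2. $A_o$ is closed, $\mathbb C^+$ is contained in its resolvent set, and for all $\alpha,\mu\in\mathbb C^+$ and $x\in\mathcal H_o$ $$\big((\alpha-A_o)^{-1}x\big)(\mu)=\frac{x(\mu)-x(\alpha)}{\alpha-\mu},\qquad \big(A_o(\alpha-A_o)^{-1}x\big)(\mu)=\frac{\mu x(\mu)-\alpha x(\alpha)}{\alpha-\mu},\qquad C_o(\alpha-A_o)^{-1}x=x(\alpha).$$ 3. For every $\beta\in\mathbb C^+$, the operators $A_o|_{\mathcal H_o}$ and $B_o$ exist and are unique, $\alpha-A_o|_{\mathcal H_o}$ is a bijection of $\mathcal H_o$ onto $\mathcal H_{o,-1}$ for all $\alpha\in\mathbb C^+$, and $$\big((\alpha-A_o|_{\mathcal H_o})^{-1}B_ou\big)(\mu)=\frac{\varphi(\mu)-\varphi(\alpha)}{\alpha-\mu}\,u,\qquad \alpha,\mu\in\mathbb C^+,\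 u\in\mathcal U.$$ -/

import Mathlib

open Filter Topology ComplexConjugate

/-! ### The Schur class on the right half-plane and the de Branges-Rovnyak kernel -/

/-- The open right half-plane `ℂ⁺`. -/
abbrev RHP : Type := {μ : ℂ // 0 < μ.re}

/-- The Schur class `𝒮(ℂ⁺; U, Y)`: holomorphic functions on the right half-plane whose values are
contractions from `U` to `Y`. (The values of `toFun` off the half-plane are irrelevant and are
never used.) -/
structure SchurClass (U Y : Type*)
    [NormedAddCommGroup U] [InnerProductSpace ℂ U]
    [NormedAddCommGroup Y] [InnerProductSpace ℂ Y] where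
  toFun : ℂ → U →L[ℂ] Y
  differentiableOn : DifferentiableOn ℂ toFun {μ | 0 < μ.re}
  norm_le_one : ∀ μ : ℂ, 0 < μ.re → ‖toFun μ‖ ≤ 1

instance SchurClass.instCoeFun {U Y : Type*}
    [NormedAddCommGroup U] [InnerProductSpace ℂ U]
    [NormedAddCommGroup Y] [InnerProductSpace ℂ Y] :
    CoeFun (SchurClass U Y) (fun _ => ℂ → U →L[ℂ] Y) := ⟨SchurClass.toFun⟩

/-- The kernel `K_o(μ, l) = (1 - φ(μ) φ(l)^*) / (μ + conj l)` on the right half-plane. -/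
noncomputable def kernelO {U Y : Type*}
    [NormedAddCommGroup U] [InnerProductSpace ℂ U] [CompleteSpace U]
    [NormedAddCommGroup Y] [InnerProductSpace ℂ Y] [CompleteSpace Y]
    (φ : SchurClass U Y) : Matrix RHP RHP (Y →L[ℂ] Y) :=
  Matrix.of fun μ l =>
    ((μ : ℂ) + conj (l : ℂ))⁻¹ •
      (ContinuousLinearMap.id ℂ Y - (φ μ) ∘L (ContinuousLinearMap.adjoint (φ l)))

open Metric in
theorem circleAverage_inner_kernel {E : Type*} [NormedAddCommGroup E] [InnerProductSpace ℂ E]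
    {c : ℂ} {r : ℝ} (hr : 0 < r) {w : ℂ} (hw : w ∈ ball c r) (v : E) {F : ℂ → E}
    (hF : DifferentiableOn ℂ F (closedBall c r)) :
    Real.circleAverage
      (fun ζ => inner ℂ ((1 - (ζ - c) * conj (w - c) / (r : ℂ) ^ 2)⁻¹ • v) (F ζ)) c r
      = inner ℂ v (F w) := by
  have hd : DifferentiableOn ℂ (fun ζ => inner ℂ v (F ζ)) (closedBall c r) := by
    have h1 : DifferentiableOn ℂ (innerSL ℂ v : E → ℂ) Set.univ :=
      (innerSL ℂ v).differentiable.differentiableOn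
    exact h1.comp hF (fun _ _ => Set.mem_univ _)
  have hdc : DiffContOnCl ℂ (fun ζ => inner ℂ v (F ζ)) (ball c |r|) := by
    rw [abs_of_pos hr]
    exact DifferentiableOn.diffContOnCl (by rwa [closure_ball c hr.ne'])
  rw [← hdc.circleAverage_smul_div (w := w) (by rwa [abs_of_pos hr])]
  apply Real.circleAverage_congr_sphere
  intro ζ hζ
  rw [abs_of_pos hr, mem_sphere_iff_norm] at hζ
  have hζ0 : ζ - c ≠ 0 := by
    rw [← norm_pos_iff, hζ]; exact hr
  have hζw : ζ - w ≠ 0 := by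
    intro h
    rw [sub_eq_zero] at h
    rw [mem_ball_iff_norm, ← h, hζ] at hw
    exact lt_irrefl _ hw
  have hconj : conj (ζ - c) * (ζ - c) = (r : ℂ) ^ 2 := by
    rw [mul_comm, Complex.mul_conj, Complex.normSq_eq_norm_sq, hζ]; push_cast; rfl
  have hr0 : (r : ℂ) ^ 2 ≠ 0 := by
    simpa using hr.ne'
  have hc0 : conj (ζ - c) ≠ 0 := by
    intro h; rw [h, zero_mul] at hconj; exact hr0 hconj.symm
  simp only [inner_smul_left, smul_eq_mul]
  congr 1
  rw [map_inv₀, map_sub, map_one, map_div₀, map_mul, Complex.conj_conj, map_pow,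
    Complex.conj_ofReal, ← hconj]
  have : 1 - conj (ζ - c) * (w - c) / (conj (ζ - c) * (ζ - c)) = (ζ - w) / (ζ - c) := by
    field_simp
    ring
  rw [this, inv_div]

open Metric in
theorem circleAverage_inner_sum_kernel {E : Type*} [NormedAddCommGroup E]
    [InnerProductSpace ℂ E] {c : ℂ} {r : ℝ} (hr : 0 < r) {ι : Type*} (s : Finset ι) (p : ι → ℂ)
    (hp : ∀ i ∈ s, p i ∈ ball c r)
    (hkd : ∀ j ∈ s, DifferentiableOn ℂ
      (fun ζ => (1 - (ζ - c) * conj (p j - c) / (r : ℂ) ^ 2)⁻¹) (closedBall c r))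
    (a : ι → E) (F : ℂ → E) (hF : DifferentiableOn ℂ F (closedBall c r)) :
    Real.circleAverage (fun ζ => inner ℂ
      (∑ j ∈ s, (1 - (ζ - c) * conj (p j - c) / (r : ℂ) ^ 2)⁻¹ • a j) (F ζ)) c r
        = ∑ j ∈ s, inner ℂ (a j) (F (p j)) := by
  have hsub : sphere c |r| ⊆ closedBall c r := by
    rw [abs_of_pos hr]; exact sphere_subset_closedBall
  have e : (fun ζ => inner ℂ (∑ j ∈ s, (1 - (ζ - c) * conj (p j - c) / (r : ℂ) ^ 2)⁻¹ • a j) (F ζ))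
      = ∑ j ∈ s, fun ζ => inner ℂ ((1 - (ζ - c) * conj (p j - c) / (r : ℂ) ^ 2)⁻¹ • a j) (F ζ) := by
    funext ζ
    rw [sum_inner, Finset.sum_apply]
  rw [e, Real.circleAverage_sum]
  · refine Finset.sum_congr rfl fun j hj => ?_
    exact circleAverage_inner_kernel hr (hp j hj) (a j) hF
  · intro j hj
    apply ContinuousOn.circleIntegrable'
    exact (((hkd j hj).continuousOn.mono hsub).smul continuousOn_const).inner
      (hF.continuousOn.mono hsub)

open Metric in
theorem schur_disc_positivity {U Y : Type*}
    [NormedAddCommGroup U] [InnerProductSpace ℂ U] [CompleteSpace U]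
    [NormedAddCommGroup Y] [InnerProductSpace ℂ Y] [CompleteSpace Y]
    {φ : ℂ → U →L[ℂ] Y} {c : ℂ} {r : ℝ} (hr : 0 < r)
    (hφ : DifferentiableOn ℂ φ (closedBall c r)) (hn : ∀ ζ ∈ closedBall c r, ‖φ ζ‖ ≤ 1)
    {ι : Type*} (s : Finset ι) (p : ι → ℂ) (hp : ∀ i ∈ s, p i ∈ ball c r) (v : ι → Y) :
    0 ≤ (∑ i ∈ s, ∑ j ∈ s, (1 - (p i - c) * conj (p j - c) / (r : ℂ) ^ 2)⁻¹ *
      inner ℂ (v i) (v j - φ (p i) ((φ (p j)).adjoint (v j)))).re := by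
  set k : ι → ℂ → ℂ := fun j ζ => (1 - (ζ - c) * conj (p j - c) / (r : ℂ) ^ 2)⁻¹ with hk
  set h : ℂ → Y := fun ζ => ∑ j ∈ s, k j ζ • v j with hh
  set g : ℂ → U := fun ζ => ∑ j ∈ s, k j ζ • (φ (p j)).adjoint (v j) with hg
  have hkd : ∀ j ∈ s, DifferentiableOn ℂ (k j) (closedBall c r) := by
    intro j hj ζ hζ
    have hne : 1 - (ζ - c) * conj (p j - c) / (r : ℂ) ^ 2 ≠ 0 := by
      intro h0
      have h1 : (ζ - c) * conj (p j - c) / (r : ℂ) ^ 2 = 1 := (sub_eq_zero.mp h0).symm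
      have h2 := congrArg norm h1
      rw [norm_div, norm_mul, RCLike.norm_conj, norm_pow, Complex.norm_real, Real.norm_eq_abs,
        sq_abs, norm_one, div_eq_one_iff_eq (by positivity)] at h2
      have h3 := hp j hj
      rw [mem_ball_iff_norm] at h3
      rw [mem_closedBall_iff_norm] at hζ
      nlinarith [norm_nonneg (ζ - c), norm_nonneg (p j - c)]
    have : DifferentiableAt ℂ (k j) ζ := by
      simp only [hk]
      exact DifferentiableAt.inv (by fun_prop) hne
    exact this.differentiableWithinAt
  have hhd : DifferentiableOn ℂ h (closedBall c r) :=
    DifferentiableOn.fun_sum fun j hj => (hkd j hj).smul_const _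
  have hgd : DifferentiableOn ℂ g (closedBall c r) :=
    DifferentiableOn.fun_sum fun j hj => (hkd j hj).smul_const _
  have hfd : DifferentiableOn ℂ (fun ζ => φ ζ (g ζ)) (closedBall c r) := hφ.clm_apply hgd
  have hsub : sphere c |r| ⊆ closedBall c r := by
    rw [abs_of_pos hr]; exact sphere_subset_closedBall
  -- averages
  have E1 := circleAverage_inner_sum_kernel hr s p hp hkd v h hhd
  have E2 := circleAverage_inner_sum_kernel hr s p hp hkd (fun j => (φ (p j)).adjoint (v j)) g hgd
  have E3 := circleAverage_inner_sum_kernel hr s p hp hkd v (fun ζ => φ ζ (g ζ)) hfd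
  have E3' : ∑ j ∈ s, inner ℂ (v j) (φ (p j) (g (p j)))
      = ∑ j ∈ s, inner ℂ ((φ (p j)).adjoint (v j)) (g (p j)) := by
    simp only [ContinuousLinearMap.adjoint_inner_left]
  have i1 : CircleIntegrable (fun ζ => inner ℂ (h ζ) (h ζ)) c r :=
    ContinuousOn.circleIntegrable' ((hhd.continuousOn.mono hsub).inner (hhd.continuousOn.mono hsub))
  have i2 : CircleIntegrable (fun ζ => inner ℂ (g ζ) (g ζ)) c r :=
    ContinuousOn.circleIntegrable' ((hgd.continuousOn.mono hsub).inner (hgd.continuousOn.mono hsub))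
  have i3 : CircleIntegrable (fun ζ => inner ℂ (h ζ) (φ ζ (g ζ))) c r :=
    ContinuousOn.circleIntegrable' ((hhd.continuousOn.mono hsub).inner (hfd.continuousOn.mono hsub))
  have re_avg : ∀ {f : ℂ → ℂ}, CircleIntegrable f c r →
      (Real.circleAverage f c r).re = (2 * Real.pi)⁻¹ *
        ∫ θ in 0..2 * Real.pi, (f (circleMap c r θ)).re := by
    intro f hf
    have := Complex.reCLM.intervalIntegral_comp_comm (μ := MeasureTheory.volume) hf
    rw [Real.circleAverage, Complex.smul_re, smul_eq_mul]
    congr 1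
    exact this.symm
  have ir : ∀ {f : ℂ → ℂ}, CircleIntegrable f c r → IntervalIntegrable
      (fun θ => (f (circleMap c r θ)).re) MeasureTheory.volume 0 (2 * Real.pi) := by
    intro f hf
    exact ⟨hf.1.re, hf.2.re⟩
  have r1 := re_avg i1
  have r2 := re_avg i2
  have r3 := re_avg i3
  have hpos : 0 ≤ ∫ θ in 0..2 * Real.pi,
      (((inner ℂ (h (circleMap c r θ)) (h (circleMap c r θ)) : ℂ).re
        - 2 * (inner ℂ (h (circleMap c r θ)) (φ (circleMap c r θ) (g (circleMap c r θ))) : ℂ).re)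
        + (inner ℂ (g (circleMap c r θ)) (g (circleMap c r θ)) : ℂ).re) := by
    apply intervalIntegral.integral_nonneg (by positivity)
    intro θ _
    set ζ := circleMap c r θ
    have hζ : ζ ∈ closedBall c r := hsub (circleMap_mem_sphere' c r θ)
    have h1 : ‖φ ζ (g ζ)‖ ≤ ‖g ζ‖ := by
      calc ‖φ ζ (g ζ)‖ ≤ ‖φ ζ‖ * ‖g ζ‖ := (φ ζ).le_opNorm _
        _ ≤ 1 * ‖g ζ‖ := by gcongr; exact hn ζ hζ
        _ = ‖g ζ‖ := one_mul _
    have h2 := norm_sub_sq (𝕜 := ℂ) (h ζ) (φ ζ (g ζ))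
    have h3 : (inner ℂ (h ζ) (h ζ) : ℂ).re = ‖h ζ‖ ^ 2 := inner_self_eq_norm_sq (𝕜 := ℂ) _
    have h4 : (inner ℂ (g ζ) (g ζ) : ℂ).re = ‖g ζ‖ ^ 2 := inner_self_eq_norm_sq (𝕜 := ℂ) _
    rw [h3, h4]
    simp only [RCLike.re_to_complex] at h2
    have h5 := pow_le_pow_left₀ (norm_nonneg _) h1 2
    have h6 := sq_nonneg ‖h ζ - φ ζ (g ζ)‖
    linarith
  rw [intervalIntegral.integral_add ((ir i1).sub ((ir i3).const_mul 2)) (ir i2),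
    intervalIntegral.integral_sub (ir i1) ((ir i3).const_mul 2),
    intervalIntegral.integral_const_mul] at hpos
  have hfin : 0 ≤ (∑ j ∈ s, inner ℂ (v j) (h (p j))).re
      - (∑ j ∈ s, inner ℂ ((φ (p j)).adjoint (v j)) (g (p j))).re := by
    have a1 := r1
    have a2 := r2
    have a3 := r3
    rw [E1] at a1
    rw [E2] at a2
    rw [E3, E3', a2] at a3
    rw [a1, a2]
    have hpi : (0 : ℝ) < (2 * Real.pi)⁻¹ := by positivity
    have a4 := mul_left_cancel₀ hpi.ne' a3
    rw [← a4] at hpos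
    rw [← mul_sub]
    apply mul_nonneg hpi.le
    linarith
  rw [← Complex.sub_re, ← Finset.sum_sub_distrib] at hfin
  convert hfin using 2
  refine Finset.sum_congr rfl fun i _ => ?_
  simp only [hh, hg, inner_sum, ← Finset.sum_sub_distrib]
  refine Finset.sum_congr rfl fun j _ => ?_
  rw [inner_smul_right, inner_smul_right, ContinuousLinearMap.adjoint_inner_left, ← mul_sub,
    ← inner_sub_right]

theorem kernelO_apply {U Y : Type*}
    [NormedAddCommGroup U] [InnerProductSpace ℂ U] [CompleteSpace U]
    [NormedAddCommGroup Y] [InnerProductSpace ℂ Y] [CompleteSpace Y]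
    (φ : SchurClass U Y) (μ l : RHP) (y : Y) :
    kernelO φ μ l y = ((μ : ℂ) + conj (l : ℂ))⁻¹ • (y - φ μ ((φ l).adjoint y)) := rfl

open Metric in
theorem schur_halfPlane_positivity {U Y : Type*}
    [NormedAddCommGroup U] [InnerProductSpace ℂ U] [CompleteSpace U]
    [NormedAddCommGroup Y] [InnerProductSpace ℂ Y] [CompleteSpace Y]
    (φ : SchurClass U Y) (s : Finset RHP) (v : RHP → Y) :
    0 ≤ (∑ i ∈ s, ∑ j ∈ s, inner ℂ (v i) (kernelO φ i j (v j))).re := by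
  have hlim : Tendsto (fun R : ℝ => (∑ i ∈ s, ∑ j ∈ s,
      (((i : ℂ) + conj (j : ℂ)) - ((i : ℂ) * conj (j : ℂ) + 1) * (R⁻¹ : ℝ))⁻¹ *
      inner ℂ (v i) (v j - φ i ((φ j).adjoint (v j)))).re) atTop
      (𝓝 (∑ i ∈ s, ∑ j ∈ s, inner ℂ (v i) (kernelO φ i j (v j))).re) := by
    refine (Complex.continuous_re.tendsto _).comp ?_
    refine tendsto_finsetSum _ fun i _ => tendsto_finsetSum _ fun j _ => ?_
    have hne : (i : ℂ) + conj (j : ℂ) ≠ 0 := by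
      intro h0
      have := congrArg Complex.re h0
      simp only [Complex.add_re, Complex.conj_re, Complex.zero_re] at this
      linarith [i.2, j.2]
    have h1 : Tendsto (fun R : ℝ => ((R⁻¹ : ℝ) : ℂ)) atTop (𝓝 0) := by
      have := (Complex.continuous_ofReal.tendsto 0).comp tendsto_inv_atTop_zero
      rw [Complex.ofReal_zero] at this
      exact this
    have h2 : Tendsto (fun R : ℝ => (((i : ℂ) + conj (j : ℂ)) -
        ((i : ℂ) * conj (j : ℂ) + 1) * (R⁻¹ : ℝ))⁻¹) atTop (𝓝 ((i : ℂ) + conj (j : ℂ))⁻¹) := by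
      have := (tendsto_const_nhds (x := (i : ℂ) + conj (j : ℂ))).sub
        (h1.const_mul ((i : ℂ) * conj (j : ℂ) + 1))
      rw [mul_zero, sub_zero] at this
      exact this.inv₀ hne
    have h3 := h2.mul_const (inner ℂ (v i) (v j - φ i ((φ j).adjoint (v j))))
    convert h3 using 2
    simp [kernelO_apply]
  refine ge_of_tendsto hlim ?_
  have hev : ∀ᶠ R : ℝ in atTop, 1 < R ∧ ∀ i ∈ s, ‖(i : ℂ)‖ ^ 2 + 1 < 2 * R * (i : ℂ).re := by
    refine (eventually_gt_atTop 1).and ?_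
    rw [Finset.eventually_all]
    intro i _
    filter_upwards [eventually_gt_atTop ((‖(i : ℂ)‖ ^ 2 + 1) / (2 * (i : ℂ).re))] with R hR
    rw [div_lt_iff₀ (by linarith [i.2])] at hR
    linarith
  filter_upwards [hev] with R hR
  obtain ⟨hR1, hR2⟩ := hR
  have hq : 0 < R ^ 2 - 1 := by nlinarith
  set r := √(R ^ 2 - 1) with hr
  have hr0 : 0 < r := Real.sqrt_pos.mpr hq
  have hrsq : r ^ 2 = R ^ 2 - 1 := Real.sq_sqrt hq.le
  have hrR : r < R := by nlinarith
  have hsub : closedBall (R : ℂ) r ⊆ {μ : ℂ | 0 < μ.re} := by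
    intro ζ hζ
    rw [mem_closedBall_iff_norm] at hζ
    have h1 := (Complex.abs_re_le_norm (ζ - R)).trans hζ
    have h2 := (abs_le.mp h1).1
    simp only [Complex.sub_re, Complex.ofReal_re] at h2
    show 0 < ζ.re
    linarith
  have hp : ∀ i ∈ s, (i : ℂ) ∈ ball (R : ℂ) r := by
    intro i hi
    rw [mem_ball_iff_norm]
    refine lt_of_pow_lt_pow_left₀ 2 hr0.le ?_
    have h1 := hR2 i hi
    have h2 : ‖(i : ℂ) - R‖ ^ 2 = ‖(i : ℂ)‖ ^ 2 - 2 * R * (i : ℂ).re + R ^ 2 := by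
      rw [← Complex.normSq_eq_norm_sq, ← Complex.normSq_eq_norm_sq, Complex.normSq_apply,
        Complex.normSq_apply]
      simp
      ring
    rw [h2, hrsq]
    linarith
  have hmain := schur_disc_positivity hr0 (φ.differentiableOn.mono hsub)
    (fun ζ hζ => φ.norm_le_one ζ (hsub hζ)) s (fun i : RHP => (i : ℂ)) hp v
  have hfac : ∀ i ∈ s, ∀ j ∈ s,
      (((i : ℂ) + conj (j : ℂ)) - ((i : ℂ) * conj (j : ℂ) + 1) * (R⁻¹ : ℝ))⁻¹
      = ((R / r ^ 2 : ℝ) : ℂ) * (1 - ((i : ℂ) - R) * conj ((j : ℂ) - R) / (r : ℂ) ^ 2)⁻¹ := by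
    intro i _ j _
    have hRc : (R : ℂ) ≠ 0 := by
      have : R ≠ 0 := by linarith
      exact_mod_cast this
    have hrc : (r : ℂ) ≠ 0 := by exact_mod_cast hr0.ne'
    have hrsqc : (r : ℂ) ^ 2 = (R : ℂ) ^ 2 - 1 := by exact_mod_cast hrsq
    have e1 : ((i : ℂ) + conj (j : ℂ)) - ((i : ℂ) * conj (j : ℂ) + 1) * (R⁻¹ : ℝ)
        = ((r : ℂ) ^ 2 / R) * (1 - ((i : ℂ) - R) * conj ((j : ℂ) - R) / (r : ℂ) ^ 2) := by
      rw [map_sub, Complex.conj_ofReal, Complex.ofReal_inv]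
      field_simp
      rw [hrsqc]
      ring
    rw [e1, mul_inv, inv_div]
    push_cast
    rfl
  have hre : (∑ i ∈ s, ∑ j ∈ s,
      (((i : ℂ) + conj (j : ℂ)) - ((i : ℂ) * conj (j : ℂ) + 1) * (R⁻¹ : ℝ))⁻¹ *
      inner ℂ (v i) (v j - φ i ((φ j).adjoint (v j))))
      = ((R / r ^ 2 : ℝ) : ℂ) * ∑ i ∈ s, ∑ j ∈ s,
        (1 - ((i : ℂ) - R) * conj ((j : ℂ) - R) / (r : ℂ) ^ 2)⁻¹ *
        inner ℂ (v i) (v j - φ i ((φ j).adjoint (v j))) := by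
    rw [Finset.mul_sum]
    refine Finset.sum_congr rfl fun i hi => ?_
    rw [Finset.mul_sum]
    refine Finset.sum_congr rfl fun j hj => ?_
    rw [hfac i hi j hj, mul_assoc]
  rw [hre, Complex.re_ofReal_mul]
  exact mul_nonneg (div_nonneg (by linarith) (by positivity)) hmain

open scoped ComplexOrder in
/-- The kernel `K_o` is a positive kernel. -/
theorem posSemidef_kernelO {U Y : Type*}
    [NormedAddCommGroup U] [InnerProductSpace ℂ U] [CompleteSpace U]
    [NormedAddCommGroup Y] [InnerProductSpace ℂ Y] [CompleteSpace Y]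
    (φ : SchurClass U Y) : (kernelO φ).PosSemidef := by
  have hherm : (kernelO φ).IsHermitian := by
    ext i j y
    refine ext_inner_left ℂ fun w => ?_
    rw [Matrix.conjTranspose_apply, ContinuousLinearMap.star_eq_adjoint,
      ContinuousLinearMap.adjoint_inner_right, kernelO_apply, kernelO_apply, inner_smul_left,
      inner_smul_right, inner_sub_left, inner_sub_right, ← ContinuousLinearMap.adjoint_inner_right,
      ContinuousLinearMap.adjoint_inner_left, map_inv₀, map_add, Complex.conj_conj, add_comm]
  have htfae := (RKHS.posSemidef_tfae (K := kernelO φ)).out 0 2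
  refine htfae.mpr ⟨hherm, fun vv => ?_⟩
  have h := schur_halfPlane_positivity φ vv.support vv
  rw [← RCLike.conj_re]
  simp only [Finsupp.sum, map_sum, inner_conj_symm, RCLike.re_to_complex]
  rw [Finset.sum_comm]
  simpa only [Complex.re_sum] using h

instance fact_posSemidef_kernelO {U Y : Type*}
    [NormedAddCommGroup U] [InnerProductSpace ℂ U] [CompleteSpace U]
    [NormedAddCommGroup Y] [InnerProductSpace ℂ Y] [CompleteSpace Y]
    (φ : SchurClass U Y) : Fact (kernelO φ).PosSemidef := ⟨posSemidef_kernelO φ⟩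

/-! ### Operators attached to a node -/

section Nodes

variable {X U Y : Type*}
  [NormedAddCommGroup X] [InnerProductSpace ℂ X]
  [NormedAddCommGroup U] [InnerProductSpace ℂ U]
  [NormedAddCommGroup Y] [InnerProductSpace ℂ Y]

/-- The main operator `A` of `S = [A&B; C&D]`: `A x = [A&B] (x, 0)`, with domain the set of
all `x` such that `(x, 0)` lies in the domain of `S`. -/
noncomputable def mainOperator
    (S : WithLp 2 (X × U) →ₗ.[ℂ] WithLp 2 (X × Y)) : X →ₗ.[ℂ] X where
  domain :=
    { carrier := {x | WithLp.toLp 2 (x, (0 : U)) ∈ S.domain}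
      zero_mem' := S.domain.zero_mem
      add_mem' := by
        intro a b ha hb
        have h := S.domain.add_mem ha hb
        rw [← WithLp.toLp_add, Prod.mk_add_mk, add_zero] at h
        exact h
      smul_mem' := by
        intro c a ha
        have h := S.domain.smul_mem c ha
        rw [← WithLp.toLp_smul, Prod.smul_mk, smul_zero] at h
        exact h }
  toFun :=
    { toFun := fun x => (S ⟨WithLp.toLp 2 ((x : X), (0 : U)), x.2⟩).fst
      map_add' := by
        intro a b
        rw [← WithLp.add_fst, ← S.map_add]
        congr 2
        exact Subtype.ext (by simp [← WithLp.toLp_add])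
      map_smul' := by
        intro c a
        rw [RingHom.id_apply, ← WithLp.smul_fst, ← S.map_smul]
        congr 2
        exact Subtype.ext (by simp [← WithLp.toLp_smul]) }

/-- The observation operator `C` of `S = [A&B; C&D]`: `C x = [C&D] (x, 0)`, defined on the domain
of the main operator. -/
noncomputable def observationOperator
    (S : WithLp 2 (X × U) →ₗ.[ℂ] WithLp 2 (X × Y)) : (mainOperator S).domain →ₗ[ℂ] Y where
  toFun := fun x => (S ⟨WithLp.toLp 2 ((x : X), (0 : U)), x.2⟩).snd
  map_add' := by
    intro a b
    rw [← WithLp.add_snd, ← S.map_add]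
    congr 2
    exact Subtype.ext (by simp [← WithLp.toLp_add])
  map_smul' := by
    intro c a
    rw [RingHom.id_apply, ← WithLp.smul_snd, ← S.map_smul]
    congr 2
    exact Subtype.ext (by simp [← WithLp.toLp_smul])

/-- The operator `α - A`, as a linear map on the domain of `A`. -/
def shiftOp (A : X →ₗ.[ℂ] X) (α : ℂ) : A.domain →ₗ[ℂ] X :=
  α • A.domain.subtype - A.toFun

/-- The resolvent set of an operator `A` on `X`: all `α` such that `α - A` maps the domain of `A`
one-to-one onto `X`. -/
def resolventSetOp (A : X →ₗ.[ℂ] X) : Set ℂ :=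
  {α | Function.Bijective (shiftOp A α)}

open Classical in
/-- The resolvent `(α - A)⁻¹`, as a map from `X` onto the domain of `A`
(it is set to `0` if `α` is not in the resolvent set). -/
noncomputable def resolventOp (A : X →ₗ.[ℂ] X) (α : ℂ) : X →ₗ[ℂ] A.domain :=
  if h : Function.Bijective (shiftOp A α) then
    ((LinearEquiv.ofBijective (shiftOp A α) h).symm : X →ₗ[ℂ] A.domain)
  else 0

/-- The space `X` with the norm `‖x‖_{-1} = ‖(β - A)⁻¹ x‖`. -/
@[nolint unusedArguments]
def WeakNormed (_A : X →ₗ.[ℂ] X) (_β : ℂ) : Type _ := X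

instance WeakNormed.instAddCommGroup (A : X →ₗ.[ℂ] X) (β : ℂ) :
    AddCommGroup (WeakNormed A β) := inferInstanceAs (AddCommGroup X)

instance WeakNormed.instModule (A : X →ₗ.[ℂ] X) (β : ℂ) :
    Module ℂ (WeakNormed A β) := inferInstanceAs (Module ℂ X)

/-- `(β - A)⁻¹` as a map on `X` with the weak norm. -/
noncomputable def WeakNormed.res (A : X →ₗ.[ℂ] X) (β : ℂ) : WeakNormed A β →ₗ[ℂ] X :=
  A.domain.subtype ∘ₗ resolventOp A β

noncomputable instance WeakNormed.instSeminormedAddCommGroup (A : X →ₗ.[ℂ] X) (β : ℂ) :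
    SeminormedAddCommGroup (WeakNormed A β) :=
  SeminormedAddCommGroup.induced _ _ (WeakNormed.res A β)

noncomputable instance WeakNormed.instNormedSpace (A : X →ₗ.[ℂ] X) (β : ℂ) :
    NormedSpace ℂ (WeakNormed A β) :=
  NormedSpace.induced ℂ _ _ (WeakNormed.res A β)

/-- The rigged space `X_{-1}`: the completion of `X` in the norm `‖x‖_{-1} = ‖(β - A)⁻¹ x‖`. -/
abbrev RiggedSpace (A : X →ₗ.[ℂ] X) (β : ℂ) : Type _ :=
  UniformSpace.Completion (WeakNormed A β)

/-- The inclusion of `X` into `X_{-1}`. -/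
noncomputable def riggedIncl (A : X →ₗ.[ℂ] X) (β : ℂ) (x : X) : RiggedSpace A β :=
  UniformSpace.Completion.coe' (α := WeakNormed A β) x

/-- `T : X → X_{-1}` is a continuous extension of `A`, that is, `T = A|_X`. -/
def IsRiggedExtension (A : X →ₗ.[ℂ] X) (β : ℂ) (T : X →L[ℂ] RiggedSpace A β) : Prop :=
  ∀ x : A.domain, T x = riggedIncl A β (A x)

/-- `B : U → X_{-1}` is a control operator of `S = [A&B; C&D]`, where `T = A|_X`: the bounded
operator `[T B] : X × U → X_{-1}` extends `[A&B]`. -/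
def IsControlOperator (S : WithLp 2 (X × U) →ₗ.[ℂ] WithLp 2 (X × Y)) (β : ℂ)
    (T : X →L[ℂ] RiggedSpace (mainOperator S) β)
    (B : U →L[ℂ] RiggedSpace (mainOperator S) β) : Prop :=
  ∀ w : S.domain,
    riggedIncl (mainOperator S) β (S w).fst
      = T (w : WithLp 2 (X × U)).fst + B (w : WithLp 2 (X × U)).snd

end Nodes

/-- The function `g` on the right half-plane is `μ ↦ (f μ - f α) / (α - μ)`, where the value at
`μ = α` is understood as the limit of the quotient (the singularity is removable). -/
def IsDiffQuot {Y : Type*} [NormedAddCommGroup Y] [NormedSpace ℂ Y]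
    (f : RHP → Y) (α : RHP) (g : RHP → Y) : Prop :=
  (∀ μ : RHP, μ ≠ α → g μ = ((α : ℂ) - μ)⁻¹ • (f μ - f α)) ∧
    Tendsto (fun μ : RHP => ((α : ℂ) - μ)⁻¹ • (f μ - f α)) (𝓝[≠] α) (𝓝 (g α))

/-- The filter on the right half-plane which describes `Re η → ∞`. -/
noncomputable def reAtTop : Filter RHP := comap (fun η : RHP => (η : ℂ).re) atTop

/-! ### The state space and the observable model -/

/-- The de Branges-Rovnyak space `ℋ_o`: the Hilbert space of `Y`-valued functions on the right
half-plane with reproducing kernel `K_o`. -/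
abbrev Ho {U Y : Type*}
    [NormedAddCommGroup U] [InnerProductSpace ℂ U] [CompleteSpace U]
    [NormedAddCommGroup Y] [InnerProductSpace ℂ Y] [CompleteSpace Y]
    (φ : SchurClass U Y) : Type _ := RKHS.OfKernel (kernelO φ)

section Model

variable {U Y : Type*}
  [NormedAddCommGroup U] [InnerProductSpace ℂ U] [CompleteSpace U]
  [NormedAddCommGroup Y] [InnerProductSpace ℂ Y] [CompleteSpace Y]

/-- The closed linear span of all pairs
`((e_o(l)^* y, y), (conj l • e_o(l)^* y, φ(l)^* y))`, `l` in the right half-plane, `y` in `Y`, where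
`e_o(l)^* y = K_o(·, l) y` is the kernel function. -/
noncomputable def dualGraph (φ : SchurClass U Y) :
    Submodule ℂ (WithLp 2 (Ho φ × Y) × WithLp 2 (Ho φ × U)) :=
  (Submodule.span ℂ {q | ∃ (l : RHP) (y : Y),
    q = (WithLp.toLp 2 (RKHS.kerFun (Ho φ) l y, y),
      WithLp.toLp 2 (conj (l : ℂ) • RKHS.kerFun (Ho φ) l y,
        ContinuousLinearMap.adjoint (φ l) y))}).topologicalClosure

/-- The closed operator `[A&B; C&D]_o^*`, obtained from
`(e_o(l)^* y, y) ↦ (conj l • e_o(l)^* y, φ(l)^* y)` by linearity and limit-closure. -/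
noncomputable def dualNode (φ : SchurClass U Y) :
    WithLp 2 (Ho φ × Y) →ₗ.[ℂ] WithLp 2 (Ho φ × U) :=
  (dualGraph φ).toLinearPMap

/-- The observable co-energy-preserving model `[A&B; C&D]_o`: the adjoint of `dualNode φ`. -/
noncomputable def observableModel (φ : SchurClass U Y) :
    WithLp 2 (Ho φ × U) →ₗ.[ℂ] WithLp 2 (Ho φ × Y) :=
  (dualNode φ).adjoint

theorem inner_kerFun_kerFun (φ : SchurClass U Y) (l m : RHP) (y w : Y) :
    ((l : ℂ) + conj (m : ℂ)) *
      inner ℂ (RKHS.kerFun (Ho φ) l y) (RKHS.kerFun (Ho φ) m w)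
      = inner ℂ y w - inner ℂ ((φ l).adjoint y) ((φ m).adjoint w) := by
  have hne : (l : ℂ) + conj (m : ℂ) ≠ 0 := by
    intro h0
    have := congrArg Complex.re h0
    simp only [Complex.add_re, Complex.conj_re, Complex.zero_re] at this
    linarith [l.2, m.2]
  rw [← RKHS.kernel_inner, RKHS.OfKernel.kernel_ofKernel, kernelO_apply, inner_smul_left,
    map_inv₀, map_add, Complex.conj_conj, inner_sub_left,
    ← ContinuousLinearMap.adjoint_inner_right, add_comm (conj (m : ℂ)), mul_inv_cancel_left₀ hne]

/-- The operator `[A&B; C&D]_o^*` is scattering isometric. -/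
theorem dualGraph_isometric (φ : SchurClass U Y) {p q : WithLp 2 (Ho φ × Y) × WithLp 2 (Ho φ × U)}
    (hp : p ∈ dualGraph φ) (hq : q ∈ dualGraph φ) :
    inner ℂ p.2.fst q.1.fst + inner ℂ p.1.fst q.2.fst
      - (inner ℂ p.1.snd q.1.snd - inner ℂ p.2.snd q.2.snd) = 0 := by
  have c1 : Continuous fun p : WithLp 2 (Ho φ × Y) × WithLp 2 (Ho φ × U) => p.1.fst := by fun_prop
  have c2 : Continuous fun p : WithLp 2 (Ho φ × Y) × WithLp 2 (Ho φ × U) => p.1.snd := by fun_prop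
  have c3 : Continuous fun p : WithLp 2 (Ho φ × Y) × WithLp 2 (Ho φ × U) => p.2.fst := by fun_prop
  have c4 : Continuous fun p : WithLp 2 (Ho φ × Y) × WithLp 2 (Ho φ × U) => p.2.snd := by fun_prop
  have cl : ∀ q : WithLp 2 (Ho φ × Y) × WithLp 2 (Ho φ × U),
      IsClosed {p : WithLp 2 (Ho φ × Y) × WithLp 2 (Ho φ × U) |
        inner ℂ p.2.fst q.1.fst + inner ℂ p.1.fst q.2.fst
          - (inner ℂ p.1.snd q.1.snd - inner ℂ p.2.snd q.2.snd) = 0} := fun q =>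
    isClosed_eq (((c3.inner continuous_const).add (c1.inner continuous_const)).sub
      ((c2.inner continuous_const).sub (c4.inner continuous_const))) continuous_const
  have cr : ∀ p : WithLp 2 (Ho φ × Y) × WithLp 2 (Ho φ × U),
      IsClosed {q : WithLp 2 (Ho φ × Y) × WithLp 2 (Ho φ × U) |
        inner ℂ p.2.fst q.1.fst + inner ℂ p.1.fst q.2.fst
          - (inner ℂ p.1.snd q.1.snd - inner ℂ p.2.snd q.2.snd) = 0} := fun p =>
    isClosed_eq (((continuous_const.inner c1).add (continuous_const.inner c3)).sub
      ((continuous_const.inner c2).sub (continuous_const.inner c4))) continuous_const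
  rw [dualGraph, ← SetLike.mem_coe, Submodule.topologicalClosure_coe] at hp hq
  refine closure_minimal (fun p hp => ?_) (cl q) hp
  refine closure_minimal (fun q hq => ?_) (cr p) hq
  simp only [Set.mem_ofPred_eq]
  refine Submodule.span_induction ?_ ?_ ?_ ?_ hp
  · rintro _ ⟨l, y, rfl⟩
    refine Submodule.span_induction ?_ ?_ ?_ ?_ hq
    · rintro _ ⟨m, w, rfl⟩
      change inner ℂ (conj (l : ℂ) • RKHS.kerFun (Ho φ) l y) (RKHS.kerFun (Ho φ) m w)
        + inner ℂ (RKHS.kerFun (Ho φ) l y) (conj (m : ℂ) • RKHS.kerFun (Ho φ) m w)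
        - (inner ℂ y w - inner ℂ ((φ l).adjoint y) ((φ m).adjoint w)) = 0
      rw [inner_smul_left, inner_smul_right, Complex.conj_conj, ← inner_kerFun_kerFun]
      ring
    · simp
    · intro a b _ _ ha hb
      simp only [Prod.fst_add, Prod.snd_add, WithLp.add_fst, WithLp.add_snd, inner_add_right]
      linear_combination ha + hb
    · intro c a _ ha
      simp only [Prod.smul_fst, Prod.smul_snd, WithLp.smul_fst, WithLp.smul_snd, inner_smul_right]
      linear_combination c * ha
  · simp
  · intro a b _ _ ha hb
    simp only [Prod.fst_add, Prod.snd_add, WithLp.add_fst, WithLp.add_snd, inner_add_left]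
    linear_combination ha + hb
  · intro c a _ ha
    simp only [Prod.smul_fst, Prod.smul_snd, WithLp.smul_fst, WithLp.smul_snd, inner_smul_left]
    linear_combination conj c * ha

theorem mem_dualGraph (φ : SchurClass U Y) (l : RHP) (y : Y) :
    (WithLp.toLp 2 (RKHS.kerFun (Ho φ) l y, y),
      WithLp.toLp 2 (conj (l : ℂ) • RKHS.kerFun (Ho φ) l y, (φ l).adjoint y)) ∈ dualGraph φ :=
  Submodule.le_topologicalClosure _ (Submodule.subset_span ⟨l, y, rfl⟩)

/-- `dualGraph φ` is the graph of an operator. -/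
theorem dualGraph_singleValued (φ : SchurClass U Y)
    (p : WithLp 2 (Ho φ × Y) × WithLp 2 (Ho φ × U)) (hp : p ∈ dualGraph φ) (h0 : p.1 = 0) :
    p.2 = 0 := by
  have hs : p.2.snd = 0 := by
    have h := dualGraph_isometric φ hp hp
    simpa [h0] using h
  have hf : p.2.fst = 0 := by
    refine RKHS.ext fun l => ext_inner_right ℂ fun y => ?_
    have h := dualGraph_isometric φ hp (mem_dualGraph φ l y)
    simpa [h0, hs] using h
  exact WithLp.ofLp_injective 2 (Prod.ext hf hs)

theorem graph_dualNode (φ : SchurClass U Y) : (dualNode φ).graph = dualGraph φ :=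
  (dualGraph φ).toLinearPMap_graph_eq (dualGraph_singleValued φ)

/-- `[A&B; C&D]_o^*` is densely defined. -/
theorem dense_dualNode_domain (φ : SchurClass U Y) :
    Dense ((dualNode φ).domain : Set (WithLp 2 (Ho φ × Y))) := by
  rw [Submodule.dense_iff_topologicalClosure_eq_top, Submodule.topologicalClosure_eq_top_iff,
    Submodule.eq_bot_iff]
  intro v hv
  have h1 : ∀ l : RHP, v.fst l + v.snd = 0 := by
    intro l
    refine ext_inner_left ℂ fun y => ?_
    have hm : WithLp.toLp 2 (RKHS.kerFun (Ho φ) l y, y) ∈ (dualNode φ).domain :=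
      ⟨_, mem_dualGraph φ l y, rfl⟩
    have h := (Submodule.mem_orthogonal _ _).mp hv _ hm
    simpa [WithLp.prod_inner_apply, inner_add_right] using h
  have h2 : v.snd = 0 := by
    -- the values `v.fst l` are constant, and tend to `0` as `l → ∞`
    have hb : ∀ t : ℝ, 0 < t → 2 * t * ‖v.snd‖ ^ 2 ≤ ‖v.fst‖ ^ 2 := by
      intro t ht
      have hl : v.fst ⟨(t : ℂ), by simpa using ht⟩ = -v.snd := eq_neg_of_add_eq_zero_left (h1 _)
      set l : RHP := ⟨(t : ℂ), by simpa using ht⟩ with hldef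
      have e1 := RKHS.norm_apply_le v.fst l
      have e2 : ‖RKHS.kernel (Ho φ) l l‖ ≤ (2 * t)⁻¹ := by
        rw [RKHS.norm_kernel_eq_norm_kerFun_sq]
        have e3 : ‖RKHS.kerFun (Ho φ) l‖ ≤ √((2 * t)⁻¹) := by
          refine ContinuousLinearMap.opNorm_le_bound _ (Real.sqrt_nonneg _) fun y => ?_
          have e4 := inner_kerFun_kerFun φ l l y y
          have e5 : (2 * t) * ‖RKHS.kerFun (Ho φ) l y‖ ^ 2 = ‖y‖ ^ 2 - ‖(φ l).adjoint y‖ ^ 2 := by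
            rw [inner_self_eq_norm_sq_to_K, inner_self_eq_norm_sq_to_K,
              inner_self_eq_norm_sq_to_K] at e4
            simp only [hldef, Complex.conj_ofReal, Complex.coe_algebraMap] at e4
            have e6 := congrArg Complex.re e4
            norm_cast at e6
            linarith
          have e7 : ‖RKHS.kerFun (Ho φ) l y‖ ^ 2 ≤ (2 * t)⁻¹ * ‖y‖ ^ 2 := by
            rw [inv_mul_eq_div, le_div_iff₀ (by positivity)]
            nlinarith [sq_nonneg ‖(φ l).adjoint y‖]
          calc ‖RKHS.kerFun (Ho φ) l y‖ = √(‖RKHS.kerFun (Ho φ) l y‖ ^ 2) :=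
                (Real.sqrt_sq (norm_nonneg _)).symm
            _ ≤ √((2 * t)⁻¹ * ‖y‖ ^ 2) := Real.sqrt_le_sqrt e7
            _ = √((2 * t)⁻¹) * ‖y‖ := by
                rw [Real.sqrt_mul (by positivity), Real.sqrt_sq (norm_nonneg _)]
        calc ‖RKHS.kerFun (Ho φ) l‖ ^ 2 ≤ √((2 * t)⁻¹) ^ 2 := by gcongr
          _ = (2 * t)⁻¹ := Real.sq_sqrt (by positivity)
      rw [hl, norm_neg] at e1
      have e8 : ‖v.snd‖ ^ 2 ≤ ‖v.fst‖ ^ 2 * (2 * t)⁻¹ := by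
        calc ‖v.snd‖ ^ 2 ≤ (‖v.fst‖ * √‖RKHS.kernel (Ho φ) l l‖) ^ 2 := by gcongr
          _ = ‖v.fst‖ ^ 2 * ‖RKHS.kernel (Ho φ) l l‖ := by
              rw [mul_pow, Real.sq_sqrt (norm_nonneg _)]
          _ ≤ _ := by gcongr
      rw [← div_eq_mul_inv, le_div_iff₀ (by positivity)] at e8
      linarith
    by_contra hne
    have hpos : 0 < ‖v.snd‖ ^ 2 := by positivity
    have := hb ((‖v.fst‖ ^ 2 + 1) / ‖v.snd‖ ^ 2) (by positivity)
    rw [mul_assoc, div_mul_cancel₀ _ hpos.ne'] at this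
    nlinarith [sq_nonneg ‖v.fst‖]
  have h3 : v.fst = 0 := by
    refine RKHS.ext fun l => ?_
    have := h1 l
    rw [h2, add_zero] at this
    simpa using this
  exact WithLp.ofLp_injective 2 (Prod.ext h3 h2)

end Model

/-- The main operator `A_o` of the observable model. -/
noncomputable abbrev mainOpO {U Y : Type*}
    [NormedAddCommGroup U] [InnerProductSpace ℂ U] [CompleteSpace U]
    [NormedAddCommGroup Y] [InnerProductSpace ℂ Y] [CompleteSpace Y]
    (φ : SchurClass U Y) : Ho φ →ₗ.[ℂ] Ho φ :=
  mainOperator (observableModel φ)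

/-- The observation operator `C_o` of the observable model. -/
noncomputable abbrev obsOpO {U Y : Type*}
    [NormedAddCommGroup U] [InnerProductSpace ℂ U] [CompleteSpace U]
    [NormedAddCommGroup Y] [InnerProductSpace ℂ Y] [CompleteSpace Y]
    (φ : SchurClass U Y) : (mainOpO φ).domain →ₗ[ℂ] Y :=
  observationOperator (observableModel φ)

/-!
Taking adjoints, `(x, u)` is mapped to `(z, y)` by the model exactly when
`z(μ) + y = μ x(μ) + φ(μ) u` for all `μ`. Everything then reduces to the existence, as elements
of `ℋ_o`, of the difference quotients of `x ∈ ℋ_o` and of `φ u`.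

The dual node is isometric, so its main operator `A` and observation operator `C` satisfy
`2 Re ⟪A d, d⟫ = -‖C d‖²`. With `w = (conj α - A) d` this reads
`‖w‖² = ‖w - 2 Re α · d‖² + 2 Re α ‖C d‖²`, hence both `w ↦ w - 2 Re α · d` and `w ↦ C d` are
bounded. For `d = e_o(μ)^* y - e_o(α)^* y` one has `w = (conj α - conj μ) e_o(μ)^* y`, so the
adjoints of these two maps produce the two kinds of difference quotients. The contractivity of the
first map also shows that `A_o` is dissipative and therefore densely defined; finally `ℋ_{o,-1}`
is identified with `ℋ_o` by the unitary extension of `(β - A_o)⁻¹`.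
-/

/-! ### Linear relations and majorization in Hilbert spaces -/

section Hilbert

variable {𝕜 E F : Type*} [RCLike 𝕜]
  [NormedAddCommGroup E] [InnerProductSpace 𝕜 E] [NormedAddCommGroup F] [InnerProductSpace 𝕜 F]

theorem mem_adjoint_topologicalClosure_span {s : Set (E × F)} {x : F × E} :
    x ∈ (Submodule.span 𝕜 s).topologicalClosure.adjoint ↔
      ∀ p ∈ s, inner 𝕜 p.2 x.1 = inner 𝕜 p.1 x.2 := by
  let ℓ : E × F →L⋆[𝕜] 𝕜 := innerSLFlip 𝕜 x.1 ∘SL ContinuousLinearMap.snd 𝕜 E F -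
    innerSLFlip 𝕜 x.2 ∘SL ContinuousLinearMap.fst 𝕜 E F
  have mem_ker (p : E × F) : p ∈ ℓ.ker ↔ inner 𝕜 p.2 x.1 - inner 𝕜 p.1 x.2 = 0 := Iff.rfl
  calc x ∈ (Submodule.span 𝕜 s).topologicalClosure.adjoint
      ↔ (Submodule.span 𝕜 s).topologicalClosure ≤ ℓ.ker := by
        simp only [Submodule.mem_adjoint_iff, SetLike.le_def, Prod.forall, mem_ker]
    _ ↔ s ⊆ ℓ.ker :=
        ⟨fun h => Submodule.subset_span.trans ((Submodule.le_topologicalClosure _).trans h),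
          fun h => Submodule.topologicalClosure_minimal _ (Submodule.span_le.mpr h) ℓ.isClosed_ker⟩
    _ ↔ _ := forall₂_congr fun _ _ => sub_eq_zero

theorem exists_forall_inner_eq_of_norm_le [CompleteSpace E] [CompleteSpace F]
    {D : Type*} [AddCommGroup D] [Module 𝕜 D] (f : D →ₗ[𝕜] E) (e : D →ₗ[𝕜] F) {C : ℝ}
    (hC : 0 ≤ C) (h : ∀ d, ‖f d‖ ≤ C * ‖e d‖) :
    ∃ G : E →L[𝕜] F, ‖G‖ ≤ C ∧ ∀ d x, inner 𝕜 (e d) (G x) = inner 𝕜 (f d) x := by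
  let K := e.range.topologicalClosure
  let e' : D →ₗ[𝕜] K := e.codRestrict K fun d => e.range.le_topologicalClosure ⟨d, rfl⟩
  have he' : DenseRange e' := by
    rw [DenseRange, Subtype.dense_iff, ← Set.range_comp]
    exact subset_rfl
  let g : K →L[𝕜] E := f.extendOfNorm e'
  refine ⟨K.subtypeL ∘L g.adjoint, ?_, fun d x => ?_⟩
  · calc ‖K.subtypeL ∘L g.adjoint‖ ≤ ‖g.adjoint‖ := K.subtypeₗᵢ.norm_toContinuousLinearMap_comp.le
      _ = ‖g‖ := LinearIsometryEquiv.norm_map _ g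
      _ ≤ C := f.opNorm_extendOfNorm_le he' hC h
  · calc inner 𝕜 (e d) (g.adjoint x : F) = inner 𝕜 (g (e' d)) x := g.adjoint_inner_right (e' d) x
      _ = inner 𝕜 (f d) x := by rw [f.extendOfNorm_eq he' ⟨C, h⟩]

end Hilbert

/-! ### Resolvents, the rigged space and the control operator -/

section Operators

variable {X : Type*} [NormedAddCommGroup X] [InnerProductSpace ℂ X]

theorem shiftOp_apply (A : X →ₗ.[ℂ] X) (α : ℂ) (x : A.domain) :
    shiftOp A α x = α • (x : X) - A x := rfl

theorem re_inner_shiftOp (A : X →ₗ.[ℂ] X) (α : ℂ) (x : A.domain) :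
    (inner ℂ (shiftOp A α x) (x : X)).re =
      α.re * ‖(x : X)‖ ^ 2 - (inner ℂ (A x) (x : X)).re := by
  rw [shiftOp_apply, inner_sub_left, inner_smul_left, inner_self_eq_norm_sq_to_K, Complex.sub_re,
    RCLike.ofReal_eq_complex_ofReal, ← Complex.ofReal_pow, Complex.re_mul_ofReal, Complex.conj_re]

theorem norm_shiftOp_sq (A : X →ₗ.[ℂ] X) (α : ℂ) (x : A.domain) :
    ‖shiftOp A α x‖ ^ 2 = ‖shiftOp A α x - ((2 * α.re : ℝ) : ℂ) • (x : X)‖ ^ 2 -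
      4 * α.re * (inner ℂ (A x) (x : X)).re := by
  rw [norm_sub_sq (𝕜 := ℂ), norm_smul, mul_pow, Complex.norm_real, Real.norm_eq_abs, sq_abs,
    inner_smul_right, RCLike.re_to_complex, Complex.re_ofReal_mul, re_inner_shiftOp]
  ring

theorem dense_domain_of_dissipative [CompleteSpace X] (A : X →ₗ.[ℂ] X)
    (hA : ∀ x, (inner ℂ (A x) (x : X)).re ≤ 0) {α : ℂ} (hα : 0 < α.re)
    (hs : Function.Surjective (shiftOp A α)) : Dense (A.domain : Set X) := by
  rw [Submodule.dense_iff_topologicalClosure_eq_top, Submodule.topologicalClosure_eq_top_iff,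
    Submodule.eq_bot_iff]
  intro y hy
  obtain ⟨x, rfl⟩ := hs y
  have h0 : inner ℂ (shiftOp A α x) (x : X) = 0 := Submodule.inner_left_of_mem_orthogonal x.2 hy
  have hx : α.re * ‖(x : X)‖ ^ 2 ≤ 0 := by
    have h := re_inner_shiftOp A α x
    rw [h0, Complex.zero_re] at h
    linarith [hA x]
  have hx0 : x = 0 := by
    rw [← Subtype.coe_inj, Submodule.coe_zero, ← norm_eq_zero, ← sq_eq_zero_iff]
    exact le_antisymm (nonpos_of_mul_nonpos_right hx hα) (sq_nonneg _)
  rw [hx0, map_zero]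

section Resolvent

variable {A : X →ₗ.[ℂ] X} {α β : ℂ}

theorem resolventOp_eq_iff (hα : α ∈ resolventSetOp A) {x : X} {z : A.domain} :
    resolventOp A α x = z ↔ shiftOp A α z = x := by
  rw [resolventOp, dif_pos (Set.mem_ofPred.mp hα), eq_comm (a := shiftOp A α z)]
  exact LinearEquiv.symm_apply_eq _

theorem shiftOp_resolventOp (hα : α ∈ resolventSetOp A) (x : X) :
    shiftOp A α (resolventOp A α x) = x :=
  (resolventOp_eq_iff hα).mp rfl

theorem apply_resolventOp (hα : α ∈ resolventSetOp A) (x : X) :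
    A (resolventOp A α x) = α • (resolventOp A α x : X) - x := by
  rw [eq_sub_iff_add_eq', ← eq_sub_iff_add_eq, ← shiftOp_apply, shiftOp_resolventOp hα]

theorem resolventOp_apply (hα : α ∈ resolventSetOp A) (x : A.domain) :
    resolventOp A α (A x) = α • resolventOp A α x - x := by
  rw [eq_sub_iff_add_eq', ← eq_sub_iff_add_eq, ← map_smul, ← map_sub, eq_comm]
  exact (resolventOp_eq_iff hα).mpr rfl

theorem bijective_resolventOp (hα : α ∈ resolventSetOp A) :
    Function.Bijective (resolventOp A α) :=
  Function.bijective_iff_has_inverse.mpr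
    ⟨shiftOp A α, shiftOp_resolventOp hα, fun _ => (resolventOp_eq_iff hα).mpr rfl⟩

theorem mem_graph_iff_resolventOp_eq (hα : α ∈ resolventSetOp A) {x z : X} :
    (z, α • z - x) ∈ A.graph ↔ (resolventOp A α x : X) = z := by
  rw [LinearPMap.mem_graph_iff]
  constructor
  · rintro ⟨w, rfl, hw⟩
    rw [(resolventOp_eq_iff hα).mpr]
    rw [shiftOp_apply, hw, sub_sub_cancel]
  · rintro rfl
    exact ⟨_, rfl, apply_resolventOp hα x⟩

theorem isClosed_of_continuous_resolventOp (hα : α ∈ resolventSetOp A)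
    (h : Continuous fun x => (resolventOp A α x : X)) : A.IsClosed := by
  have graph_eq : (A.graph : Set (X × X)) =
      {p | (resolventOp A α (α • p.1 - p.2) : X) = p.1} := by
    ext p
    rw [Set.mem_ofPred_eq, ← mem_graph_iff_resolventOp_eq hα, sub_sub_cancel, SetLike.mem_coe]
  rw [LinearPMap.IsClosed, graph_eq]
  exact isClosed_eq (h.comp (by fun_prop)) continuous_fst

/-- The resolvent `(α - A)⁻¹` of a closed operator as a bounded operator on `X`. -/
noncomputable def resolventCLM [CompleteSpace X] (hA : A.IsClosed) (hα : α ∈ resolventSetOp A) :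
    X →L[ℂ] X :=
  ContinuousLinearMap.ofIsClosedGraph (g := A.domain.subtype ∘ₗ resolventOp A α) <| by
    have h : Continuous fun p : X × X => (p.2, α • p.2 - p.1) := by fun_prop
    convert hA.preimage h using 1
    ext p
    rw [Set.mem_preimage, SetLike.mem_coe, SetLike.mem_coe, mem_graph_iff_resolventOp_eq hα,
      LinearMap.mem_graph_iff, eq_comm]
    rfl

end Resolvent


theorem riggedIncl_add (A : X →ₗ.[ℂ] X) (β : ℂ) (x y : X) :
    riggedIncl A β (x + y) = riggedIncl A β x + riggedIncl A β y :=
  UniformSpace.Completion.coe_add (α := WeakNormed A β) x y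

theorem riggedIncl_smul (A : X →ₗ.[ℂ] X) (β c : ℂ) (x : X) :
    riggedIncl A β (c • x) = c • riggedIncl A β x :=
  UniformSpace.Completion.coe_smul (X := WeakNormed A β) c x

section Rigged

variable [CompleteSpace X] {A : X →ₗ.[ℂ] X} {α β : ℂ}

/-- The unitary extension of `(β - A)⁻¹` to `X_{-1}`, which identifies `X_{-1}` with `X`. -/
noncomputable def riggedEquiv (hd : Dense (A.domain : Set X)) (hβ : β ∈ resolventSetOp A) :
    RiggedSpace A β ≃ₗᵢ[ℂ] X :=
  (LinearEquiv.refl ℂ (WeakNormed A β)).extendOfIsometry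
    (UniformSpace.Completion.toComplL (𝕜 := ℂ) (E := WeakNormed A β)).toLinearMap
    (WeakNormed.res A β) UniformSpace.Completion.denseRange_coe
    (hd.denseRange_val.comp (bijective_resolventOp hβ).surjective.denseRange continuous_subtype_val)
    fun x => (UniformSpace.Completion.norm_coe x).symm

theorem riggedEquiv_riggedIncl (hd : Dense (A.domain : Set X)) (hβ : β ∈ resolventSetOp A) (x : X) :
    riggedEquiv hd hβ (riggedIncl A β x) = resolventOp A β x :=
  LinearEquiv.extendOfIsometry_eq _ _ _ _ _ _ x

/-- The continuous extension `A|_X : X → X_{-1}` of `A`: on `dom A` one has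
`(β - A)⁻¹ A = β (β - A)⁻¹ - 1`, and the right-hand side is bounded on `X`. -/
noncomputable def riggedExtension (hA : A.IsClosed) (hd : Dense (A.domain : Set X))
    (hβ : β ∈ resolventSetOp A) : X →L[ℂ] RiggedSpace A β :=
  ((riggedEquiv hd hβ).symm : X →L[ℂ] RiggedSpace A β) ∘L
    (β • resolventCLM hA hβ - ContinuousLinearMap.id ℂ X)

variable (hA : A.IsClosed) (hd : Dense (A.domain : Set X))

theorem riggedEquiv_riggedExtension (hβ : β ∈ resolventSetOp A) (x : X) :
    riggedEquiv hd hβ (riggedExtension hA hd hβ x) = β • (resolventOp A β x : X) - x :=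
  (riggedEquiv hd hβ).apply_symm_apply _

theorem isRiggedExtension_iff (hβ : β ∈ resolventSetOp A) {T : X →L[ℂ] RiggedSpace A β} :
    IsRiggedExtension A β T ↔ T = riggedExtension hA hd hβ := by
  have extends_A (x : A.domain) : riggedExtension hA hd hβ x = riggedIncl A β (A x) := by
    apply (riggedEquiv hd hβ).injective
    rw [riggedEquiv_riggedExtension, riggedEquiv_riggedIncl, resolventOp_apply hβ]
    rfl
  constructor
  · intro h
    refine DFunLike.coe_injective (T.continuous.ext_on hd (ContinuousLinearMap.continuous _) ?_)
    exact fun x hx => (h ⟨x, hx⟩).trans (extends_A ⟨x, hx⟩).symm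
  · rintro rfl
    exact extends_A

theorem riggedEquiv_smul_riggedIncl_sub (hβ : β ∈ resolventSetOp A) (α : ℂ) (x : X) :
    riggedEquiv hd hβ (α • riggedIncl A β x - riggedExtension hA hd hβ x) =
      shiftOp A α (resolventOp A β x) := by
  rw [map_sub, map_smul, riggedEquiv_riggedIncl, riggedEquiv_riggedExtension, shiftOp_apply,
    apply_resolventOp hβ]

theorem riggedEquiv_symm_apply (hβ : β ∈ resolventSetOp A) (x : X) :
    (riggedEquiv hd hβ).symm x = β • riggedIncl A β x - riggedExtension hA hd hβ x := by
  rw [LinearIsometryEquiv.symm_apply_eq, riggedEquiv_smul_riggedIncl_sub, shiftOp_resolventOp hβ]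

theorem bijective_smul_riggedIncl_sub (hβ : β ∈ resolventSetOp A) (hα : α ∈ resolventSetOp A) :
    Function.Bijective fun x => α • riggedIncl A β x - riggedExtension hA hd hβ x := by
  refine (Function.Bijective.of_comp_iff' (riggedEquiv hd hβ).bijective _).mp ?_
  rw [show riggedEquiv hd hβ ∘ _ = _ from funext (riggedEquiv_smul_riggedIncl_sub hA hd hβ α)]
  exact Function.Bijective.comp hα (bijective_resolventOp hβ)

end Rigged

section Node

variable {U Y : Type*} [NormedAddCommGroup U] [InnerProductSpace ℂ U]
  [NormedAddCommGroup Y] [InnerProductSpace ℂ Y]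
  {S : WithLp 2 (X × U) →ₗ.[ℂ] WithLp 2 (X × Y)}

theorem mem_graph_toLp_zero_iff {x z : X} {y : Y} :
    (WithLp.toLp 2 (x, (0 : U)), WithLp.toLp 2 (z, y)) ∈ S.graph ↔
      ∃ x' : (mainOperator S).domain,
        (x' : X) = x ∧ mainOperator S x' = z ∧ observationOperator S x' = y := by
  rw [LinearPMap.mem_graph_iff]
  constructor
  · rintro ⟨⟨w, hw⟩, rfl, hz⟩
    exact ⟨⟨x, hw⟩, rfl, congrArg WithLp.fst hz, congrArg WithLp.snd hz⟩
  · rintro ⟨x', rfl, rfl, rfl⟩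
    exact ⟨⟨_, x'.2⟩, rfl, rfl⟩

theorem isControlOperator_iff_forall_mem_graph {β : ℂ}
    {T : X →L[ℂ] RiggedSpace (mainOperator S) β} {B : U →L[ℂ] RiggedSpace (mainOperator S) β} :
    IsControlOperator S β T B ↔ ∀ ⦃x u z y⦄,
      (WithLp.toLp 2 (x, u), WithLp.toLp 2 (z, y)) ∈ S.graph →
        riggedIncl (mainOperator S) β z = T x + B u := by
  constructor
  · intro h x u z y hxz
    obtain ⟨w, hw, hS⟩ := (LinearPMap.mem_graph_iff _).mp hxz
    have hw' := h w
    rw [hw, hS] at hw'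
    exact hw'
  · exact fun h w => h (S.mem_graph w)

theorem IsControlOperator.smul_riggedIncl_sub {α β : ℂ}
    {T : X →L[ℂ] RiggedSpace (mainOperator S) β} {B : U →L[ℂ] RiggedSpace (mainOperator S) β}
    (hB : IsControlOperator S β T B) {x : X} {u : U} {y : Y}
    (h : (WithLp.toLp 2 (x, u), WithLp.toLp 2 (α • x, y)) ∈ S.graph) :
    α • riggedIncl (mainOperator S) β x - T x = B u := by
  rw [sub_eq_iff_eq_add', ← riggedIncl_smul, isControlOperator_iff_forall_mem_graph.mp hB h]

theorem isControlOperator_iff [CompleteSpace X] {β : ℂ} (hA : (mainOperator S).IsClosed)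
    (hd : Dense ((mainOperator S).domain : Set X)) (hβ : β ∈ resolventSetOp (mainOperator S))
    {E : U →L[ℂ] X} {D : U → Y}
    (hE : ∀ u, (WithLp.toLp 2 (E u, u), WithLp.toLp 2 (β • E u, D u)) ∈ S.graph)
    {B : U →L[ℂ] RiggedSpace (mainOperator S) β} :
    IsControlOperator S β (riggedExtension hA hd hβ) B ↔
      B = ((riggedEquiv hd hβ).symm : X →L[ℂ] RiggedSpace (mainOperator S) β) ∘L E := by
  have symm_E (u : U) :
      (((riggedEquiv hd hβ).symm : X →L[ℂ] RiggedSpace (mainOperator S) β) ∘L E) u =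
        β • riggedIncl (mainOperator S) β (E u) - riggedExtension hA hd hβ (E u) :=
    riggedEquiv_symm_apply hA hd hβ (E u)
  constructor
  · intro hB
    ext1 u
    rw [symm_E, hB.smul_riggedIncl_sub (hE u)]
  · rintro rfl
    rw [isControlOperator_iff_forall_mem_graph]
    intro x u z y hxz
    have hsub : (WithLp.toLp 2 (x - E u, (0 : U)), WithLp.toLp 2 (z - β • E u, y - D u)) ∈
        S.graph := by
      simpa only [Prod.mk_sub_mk, ← WithLp.toLp_sub, sub_self] using S.graph.sub_mem hxz (hE u)
    obtain ⟨x', hx', hAx', -⟩ := mem_graph_toLp_zero_iff.mp hsub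
    have hT := (isRiggedExtension_iff hA hd hβ).mpr rfl x'
    rw [hx', hAx', map_sub, sub_eq_iff_eq_add] at hT
    rw [symm_E, hT, ← sub_add_cancel z (β • E u), riggedIncl_add, riggedIncl_smul,
      sub_add_cancel]
    abel

end Node

end Operators

/-! ### Continuous reproducing kernels -/

section Kernel

open ContinuousLinearMap

variable {𝕜 Ω V H : Type*} [RCLike 𝕜] [TopologicalSpace Ω]
  [NormedAddCommGroup V] [InnerProductSpace 𝕜 V] [CompleteSpace V]
  [NormedAddCommGroup H] [InnerProductSpace 𝕜 H] [CompleteSpace H] [RKHS 𝕜 H Ω V]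

theorem continuous_kerFun (hK : Continuous fun p : Ω × Ω => RKHS.kernel H p.1 p.2) :
    Continuous fun ω : Ω => RKHS.kerFun H ω := by
  refine continuous_iff_continuousAt.mpr fun ν => ?_
  have norm_sq (ω : Ω) : ‖RKHS.kerFun H ω - RKHS.kerFun H ν‖ ^ 2 = ‖RKHS.kernel H ω ω -
      RKHS.kernel H ν ω - (RKHS.kernel H ω ν - RKHS.kernel H ν ν)‖ := by
    rw [sq, ← norm_adjoint_comp_self]
    simp only [map_sub, sub_comp, comp_sub, ← RKHS.kernel_apply]
  have hc : Continuous fun ω : Ω => √‖RKHS.kernel H ω ω - RKHS.kernel H ν ω -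
      (RKHS.kernel H ω ν - RKHS.kernel H ν ν)‖ :=
    ((((hK.comp (continuous_id.prodMk continuous_id)).sub
      (hK.comp (continuous_const.prodMk continuous_id))).sub
      ((hK.comp (continuous_id.prodMk continuous_const)).sub continuous_const)).norm).sqrt
  have hlim := hc.tendsto ν
  simp only [sub_self, norm_zero, Real.sqrt_zero] at hlim
  exact tendsto_iff_norm_sub_tendsto_zero.mpr
    (hlim.congr fun ω => by rw [← norm_sq, Real.sqrt_sq (norm_nonneg _)])

theorem continuous_coe_of_continuous_kernel
    (hK : Continuous fun p : Ω × Ω => RKHS.kernel H p.1 p.2) (f : H) : Continuous f := by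
  have h : Continuous fun ω : Ω => (RKHS.kerFun H ω).adjoint f :=
    (adjoint.continuous.comp (continuous_kerFun hK)).clm_apply continuous_const
  simpa only [RKHS.adjoint_kerFun] using h

end Kernel

/-! ### The right half-plane and Schur functions -/

theorem RHP.add_conj_ne_zero (μ l : RHP) : (μ : ℂ) + conj (l : ℂ) ≠ 0 := fun h => by
  have hre := congrArg Complex.re h
  rw [Complex.add_re, Complex.conj_re, Complex.zero_re] at hre
  linarith [μ.2, l.2]

theorem RHP.sub_ne_zero_of_ne {α μ : RHP} (h : μ ≠ α) : (α : ℂ) - μ ≠ 0 :=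
  sub_ne_zero.mpr fun e => h (Subtype.ext e.symm)

instance RHP.neBot_nhdsNE (α : RHP) : (𝓝[≠] α).NeBot := by
  have : ConnectedSpace RHP := isConnected_iff_connectedSpace.mp
    ((convex_halfSpace_re_gt 0).isConnected ⟨1, by simp⟩)
  have : Nontrivial RHP := ⟨⟨1, by simp⟩, ⟨2, by simp⟩, by simp [Subtype.ext_iff]⟩
  infer_instance

section DeBrangesRovnyak

variable {U Y : Type*}
  [NormedAddCommGroup U] [InnerProductSpace ℂ U]
  [NormedAddCommGroup Y] [InnerProductSpace ℂ Y]

theorem SchurClass.continuous_halfPlane (φ : SchurClass U Y) : Continuous fun μ : RHP => φ μ :=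
  continuousOn_iff_continuous_domRestrict.mp φ.differentiableOn.continuousOn

variable [CompleteSpace U] [CompleteSpace Y]

theorem continuous_kernelO (φ : SchurClass U Y) :
    Continuous fun p : RHP × RHP => kernelO φ p.1 p.2 := by
  have hinv : Continuous fun p : RHP × RHP => ((p.1 : ℂ) + conj (p.2 : ℂ))⁻¹ :=
    Continuous.inv₀ (by fun_prop) fun p => RHP.add_conj_ne_zero _ _
  have hadj : Continuous fun p : RHP × RHP => (φ p.2).adjoint :=
    ContinuousLinearMap.adjoint.continuous.comp (φ.continuous_halfPlane.comp continuous_snd)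
  exact hinv.smul (continuous_const.sub
    ((φ.continuous_halfPlane.comp continuous_fst).clm_comp hadj))

theorem norm_kerFun_sq_le (φ : SchurClass U Y) (η : RHP) (y : Y) :
    2 * (η : ℂ).re * ‖RKHS.kerFun (Ho φ) η y‖ ^ 2 ≤ ‖y‖ ^ 2 := by
  have h := congrArg Complex.re (inner_kerFun_kerFun φ η η y y)
  simp only [Complex.add_conj, inner_self_eq_norm_sq_to_K, RCLike.ofReal_eq_complex_ofReal,
    ← Complex.ofReal_pow, ← Complex.ofReal_mul, ← Complex.ofReal_sub, Complex.ofReal_re] at h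
  linarith [sq_nonneg ‖(φ η).adjoint y‖]

/-! ### Functions in the de Branges–Rovnyak space -/

namespace Ho

variable {φ : SchurClass U Y}

protected theorem continuous (x : Ho φ) : Continuous fun μ : RHP => x μ :=
  continuous_coe_of_continuous_kernel
    (by simpa only [RKHS.OfKernel.kernel_ofKernel] using continuous_kernelO φ) x

theorem ext_of_sub_smul_eq {x y : Ho φ} (α : RHP)
    (h : ∀ μ : RHP, ((α : ℂ) - μ) • x μ = ((α : ℂ) - μ) • y μ) : x = y :=
  DFunLike.coe_injective <| x.continuous.ext_on (dense_compl_singleton α) y.continuous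
    fun μ hμ => smul_right_injective Y (RHP.sub_ne_zero_of_ne hμ) (h μ)

theorem isDiffQuot {f : RHP → Y} {α : RHP} {g : Ho φ}
    (h : ∀ μ : RHP, ((α : ℂ) - μ) • g μ = f μ - f α) : IsDiffQuot f α (fun μ => g μ) := by
  have hne (μ : RHP) (hμ : μ ≠ α) : g μ = ((α : ℂ) - μ)⁻¹ • (f μ - f α) := by
    rw [← h μ, inv_smul_smul₀ (RHP.sub_ne_zero_of_ne hμ)]
  exact ⟨hne, ((g.continuous.tendsto α).mono_left nhdsWithin_le_nhds).congr'
    (eventually_nhdsWithin_of_forall hne)⟩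

theorem norm_apply_le (x : Ho φ) (η : RHP) : ‖x η‖ ≤ ‖x‖ * √(2 * (η : ℂ).re)⁻¹ := by
  have hη : 0 < 2 * (η : ℂ).re := mul_pos two_pos η.2
  refine (RKHS.norm_apply_le x η).trans (mul_le_mul_of_nonneg_left ?_ (norm_nonneg x))
  rw [← RKHS.norm_kerFun_eq_sqrt_norm_kernel]
  refine ContinuousLinearMap.opNorm_le_bound _ (Real.sqrt_nonneg _) fun y => ?_
  rw [← Real.sqrt_sq (norm_nonneg y), ← Real.sqrt_mul (inv_pos.mpr hη).le]
  exact Real.le_sqrt_of_sq_le ((le_inv_mul_iff₀ hη).mpr (norm_kerFun_sq_le φ η y))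

theorem tendsto_reAtTop (x : Ho φ) : Tendsto (fun η : RHP => x η) reAtTop (𝓝 0) := by
  have hre : Tendsto (fun η : RHP => 2 * (η : ℂ).re) reAtTop atTop :=
    tendsto_comap.const_mul_atTop two_pos
  refine squeeze_zero_norm x.norm_apply_le ?_
  simpa using (tendsto_inv_atTop_zero.comp hre).sqrt.const_mul ‖x‖

end Ho

/-! ### The graph of the observable model -/

theorem mem_graph_observableModel_iff {φ : SchurClass U Y} {p : WithLp 2 (Ho φ × U)}
    {q : WithLp 2 (Ho φ × Y)} :
    (p, q) ∈ (observableModel φ).graph ↔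
      ∀ l : RHP, q.fst l + q.snd = (l : ℂ) • p.fst l + φ l p.snd := by
  rw [observableModel, LinearPMap.adjoint_graph_eq_graph_adjoint (dense_dualNode_domain φ),
    graph_dualNode, dualGraph, mem_adjoint_topologicalClosure_span]
  have inner_iff (l : RHP) (y : Y) :
      inner ℂ (WithLp.toLp 2 (conj (l : ℂ) • RKHS.kerFun (Ho φ) l y, (φ l).adjoint y)) p =
        inner ℂ (WithLp.toLp 2 (RKHS.kerFun (Ho φ) l y, y)) q ↔
      inner ℂ y (q.fst l + q.snd) = inner ℂ y ((l : ℂ) • p.fst l + φ l p.snd) := by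
    simp only [WithLp.prod_inner_apply, inner_smul_left, Complex.conj_conj, RKHS.kerFun_inner,
      ContinuousLinearMap.adjoint_inner_left, inner_add_right, inner_smul_right, WithLp.ofLp_fst,
      WithLp.ofLp_snd, eq_comm]
  constructor
  · intro h l
    refine ext_inner_left ℂ fun y => (inner_iff l y).mp ?_
    exact h (_, _) ⟨l, y, rfl⟩
  · rintro h _ ⟨l, y, rfl⟩
    exact (inner_iff l y).mpr (congrArg (inner ℂ y) (h l))

theorem mainOpO_obsOpO_iff {φ : SchurClass U Y} {x z : Ho φ} {y : Y} :
    (∃ x' : (mainOpO φ).domain, (x' : Ho φ) = x ∧ mainOpO φ x' = z ∧ obsOpO φ x' = y) ↔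
      ∀ μ : RHP, z μ = (μ : ℂ) • x μ - y := by
  rw [← mem_graph_toLp_zero_iff, mem_graph_observableModel_iff]
  simp only [WithLp.toLp_fst, WithLp.toLp_snd, map_zero, add_zero, eq_sub_iff_add_eq]

theorem mem_domain_mainOpO_iff {φ : SchurClass U Y} {x : Ho φ} :
    x ∈ (mainOpO φ).domain ↔ ∃ y : Y, ∃ z : Ho φ, ∀ μ : RHP, z μ = (μ : ℂ) • x μ - y := by
  simp only [← mainOpO_obsOpO_iff]
  constructor
  · exact fun hx => ⟨_, _, ⟨x, hx⟩, rfl, rfl, rfl⟩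
  · rintro ⟨_, _, x', rfl, -⟩
    exact x'.2

theorem mainOpO_apply (φ : SchurClass U Y) (x : (mainOpO φ).domain) (μ : RHP) :
    mainOpO φ x μ = (μ : ℂ) • (x : Ho φ) μ - obsOpO φ x :=
  mainOpO_obsOpO_iff.mp ⟨x, rfl, rfl, rfl⟩ μ

theorem tendsto_smul_apply_reAtTop (φ : SchurClass U Y) (x : (mainOpO φ).domain) :
    Tendsto (fun η : RHP => (η : ℂ) • (x : Ho φ) η) reAtTop (𝓝 (obsOpO φ x)) := by
  simpa only [mainOpO_apply, sub_add_cancel, zero_add] using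
    (mainOpO φ x).tendsto_reAtTop.add_const (obsOpO φ x)

/-! ### The dual main operator -/

/-- The main operator of `[A&B; C&D]_o^*`. -/
noncomputable abbrev dualMainOp (φ : SchurClass U Y) : Ho φ →ₗ.[ℂ] Ho φ :=
  mainOperator (dualNode φ)

/-- The observation operator of `[A&B; C&D]_o^*`. -/
noncomputable abbrev dualObsOp (φ : SchurClass U Y) : (dualMainOp φ).domain →ₗ[ℂ] U :=
  observationOperator (dualNode φ)

theorem two_mul_re_inner_dualMainOp (φ : SchurClass U Y) (d : (dualMainOp φ).domain) :
    2 * (inner ℂ (dualMainOp φ d) (d : Ho φ)).re = -‖dualObsOp φ d‖ ^ 2 := by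
  have hd : (WithLp.toLp 2 ((d : Ho φ), (0 : Y)), WithLp.toLp 2 (dualMainOp φ d, dualObsOp φ d)) ∈
      dualGraph φ := by
    rw [← graph_dualNode]
    exact mem_graph_toLp_zero_iff.mpr ⟨d, rfl, rfl, rfl⟩
  have h := congrArg Complex.re (dualGraph_isometric φ hd hd)
  simp only [WithLp.toLp_fst, WithLp.toLp_snd, ← inner_conj_symm (d : Ho φ) (dualMainOp φ d),
    Complex.add_conj, inner_self_eq_norm_sq_to_K, RCLike.ofReal_eq_complex_ofReal, norm_zero,
    ← Complex.ofReal_pow, Complex.sub_re, Complex.ofReal_re, Complex.zero_re] at h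
  linarith

theorem norm_shiftOp_dualMainOp_sq (φ : SchurClass U Y) (α : RHP) (d : (dualMainOp φ).domain) :
    ‖shiftOp (dualMainOp φ) (conj (α : ℂ)) d‖ ^ 2 =
      ‖shiftOp (dualMainOp φ) (conj (α : ℂ)) d - ((2 * (α : ℂ).re : ℝ) : ℂ) • (d : Ho φ)‖ ^ 2 +
        2 * (α : ℂ).re * ‖dualObsOp φ d‖ ^ 2 := by
  rw [norm_shiftOp_sq, Complex.conj_re]
  linear_combination -2 * (α : ℂ).re * two_mul_re_inner_dualMainOp φ d

theorem exists_shiftOp_dualMainOp_eq (φ : SchurClass U Y) (α l : RHP) (y : Y) :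
    ∃ d : (dualMainOp φ).domain,
      (d : Ho φ) = RKHS.kerFun (Ho φ) l y - RKHS.kerFun (Ho φ) α y ∧
      shiftOp (dualMainOp φ) (conj (α : ℂ)) d = conj ((α : ℂ) - l) • RKHS.kerFun (Ho φ) l y ∧
      dualObsOp φ d = (φ l).adjoint y - (φ α).adjoint y := by
  have h := (dualGraph φ).sub_mem (mem_dualGraph φ l y) (mem_dualGraph φ α y)
  rw [← graph_dualNode, Prod.mk_sub_mk, ← WithLp.toLp_sub, ← WithLp.toLp_sub, Prod.mk_sub_mk,
    Prod.mk_sub_mk, sub_self, mem_graph_toLp_zero_iff] at h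
  obtain ⟨d, hd, hAd, hCd⟩ := h
  refine ⟨d, hd, ?_, hCd⟩
  rw [shiftOp_apply, hd, hAd, map_sub]
  module

theorem exists_diffQuot (φ : SchurClass U Y) (α : RHP) : ∃ Q : Ho φ →L[ℂ] Ho φ,
    (∀ x (μ : RHP), ((α : ℂ) - μ) • Q x μ = x μ - x α) ∧
      ∀ x, ‖x - ((2 * (α : ℂ).re : ℝ) : ℂ) • Q x‖ ≤ ‖x‖ := by
  have hα : 0 < 2 * (α : ℂ).re := mul_pos two_pos α.2
  generalize hc : ((2 * (α : ℂ).re : ℝ) : ℂ) = c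
  have hc_conj : conj c = c := hc ▸ Complex.conj_ofReal _
  have hc0 : c ≠ 0 := hc ▸ Complex.ofReal_ne_zero.mpr hα.ne'
  let w := shiftOp (dualMainOp φ) (conj (α : ℂ))
  have cayley_le (d) : ‖(w - c • (dualMainOp φ).domain.subtype) d‖ ≤ 1 * ‖w d‖ := by
    rw [one_mul, ← sq_le_sq₀ (norm_nonneg _) (norm_nonneg _), norm_shiftOp_dualMainOp_sq, hc]
    exact le_add_of_nonneg_right (by positivity)
  -- `G` is the adjoint of the contractive Cayley transform of the dual main operator.
  obtain ⟨G, hG_norm, hG⟩ := exists_forall_inner_eq_of_norm_le _ w zero_le_one cayley_le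
  refine ⟨c⁻¹ • (ContinuousLinearMap.id ℂ _ - G), fun x μ => ext_inner_left ℂ fun y => ?_,
    fun x => ?_⟩
  · obtain ⟨d, hd, hwd, -⟩ := exists_shiftOp_dualMainOp_eq φ α μ y
    have h := hG d x
    simp only [w, LinearMap.sub_apply, LinearMap.smul_apply, Submodule.subtype_apply, hd, hwd,
      inner_sub_left, inner_smul_left, Complex.conj_conj, RKHS.kerFun_inner, hc_conj] at h
    simp only [smul_apply, sub_apply, ContinuousLinearMap.id_apply, RKHS.coe_smul, RKHS.coe_sub,
      Pi.smul_apply, Pi.sub_apply, inner_smul_right, inner_sub_right]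
    field_simp
    linear_combination -h
  · rw [smul_apply, smul_inv_smul₀ hc0, sub_apply, ContinuousLinearMap.id_apply, sub_sub_cancel]
    exact G.le_of_opNorm_le_of_le hG_norm le_rfl |>.trans_eq (one_mul _)

theorem exists_schurQuot (φ : SchurClass U Y) (α : RHP) : ∃ E : U →L[ℂ] Ho φ,
    ∀ u (μ : RHP), ((α : ℂ) - μ) • E u μ = φ μ u - φ α u := by
  have hα : 0 < 2 * (α : ℂ).re := mul_pos two_pos α.2
  have norm_le (d) : ‖dualObsOp φ d‖ ≤
      √(2 * (α : ℂ).re)⁻¹ * ‖shiftOp (dualMainOp φ) (conj (α : ℂ)) d‖ := by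
    rw [← Real.sqrt_sq (norm_nonneg (shiftOp _ _ d)), ← Real.sqrt_mul (inv_pos.mpr hα).le]
    refine Real.le_sqrt_of_sq_le ((le_inv_mul_iff₀ hα).mpr ?_)
    rw [norm_shiftOp_dualMainOp_sq]
    exact le_add_of_nonneg_left (sq_nonneg _)
  obtain ⟨E, -, hE⟩ := exists_forall_inner_eq_of_norm_le _ _ (Real.sqrt_nonneg _) norm_le
  refine ⟨E, fun u μ => ext_inner_left ℂ fun y => ?_⟩
  obtain ⟨d, -, hwd, hCd⟩ := exists_shiftOp_dualMainOp_eq φ α μ y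
  simpa only [hwd, hCd, inner_sub_left, inner_smul_left, Complex.conj_conj, RKHS.kerFun_inner,
    ContinuousLinearMap.adjoint_inner_left, ← inner_smul_right, ← inner_sub_right] using hE d u

/-! ### The resolvent of the main operator -/

theorem sub_smul_apply_mainOpO (φ : SchurClass U Y) (α : RHP) (z : (mainOpO φ).domain) (μ : RHP) :
    ((α : ℂ) - μ) • (z : Ho φ) μ = shiftOp (mainOpO φ) α z μ - obsOpO φ z := by
  rw [shiftOp_apply, RKHS.coe_sub, RKHS.coe_smul, Pi.sub_apply, Pi.smul_apply, mainOpO_apply]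
  module

theorem obsOpO_eq_shiftOp_apply (φ : SchurClass U Y) (α : RHP) (z : (mainOpO φ).domain) :
    obsOpO φ z = shiftOp (mainOpO φ) α z α := by
  rw [← sub_eq_zero, ← neg_sub, ← sub_smul_apply_mainOpO, sub_self, zero_smul, neg_zero]

theorem sub_smul_apply_eq_shiftOp_sub (φ : SchurClass U Y) (α : RHP) (z : (mainOpO φ).domain)
    (μ : RHP) : ((α : ℂ) - μ) • (z : Ho φ) μ =
      shiftOp (mainOpO φ) α z μ - shiftOp (mainOpO φ) α z α := by
  rw [sub_smul_apply_mainOpO, ← obsOpO_eq_shiftOp_apply]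

theorem mem_resolventSetOp_mainOpO (φ : SchurClass U Y) (α : RHP) :
    (α : ℂ) ∈ resolventSetOp (mainOpO φ) := by
  obtain ⟨Q, hQ, -⟩ := exists_diffQuot φ α
  refine ⟨(injective_iff_map_eq_zero _).mpr fun z hz => Subtype.ext ?_, fun x => ?_⟩
  · refine Ho.ext_of_sub_smul_eq α fun μ => ?_
    rw [sub_smul_apply_eq_shiftOp_sub, hz]
    simp only [RKHS.coe_zero, Pi.zero_apply, Submodule.coe_zero, sub_zero, smul_zero]
  · have hz (μ : RHP) : ((α : ℂ) • Q x - x) μ = (μ : ℂ) • Q x μ - x α := by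
      rw [RKHS.coe_sub, RKHS.coe_smul, Pi.sub_apply, Pi.smul_apply, sub_eq_sub_iff_sub_eq_sub,
        ← sub_smul, hQ]
    obtain ⟨z, hzQ, hAz, -⟩ := mainOpO_obsOpO_iff.mpr hz
    exact ⟨z, by rw [shiftOp_apply, hzQ, hAz, sub_sub_cancel]⟩

theorem sub_smul_resolventOp_apply (φ : SchurClass U Y) (α : RHP) (x : Ho φ) (μ : RHP) :
    ((α : ℂ) - μ) • (resolventOp (mainOpO φ) α x : Ho φ) μ = x μ - x α := by
  rw [sub_smul_apply_eq_shiftOp_sub, shiftOp_resolventOp (mem_resolventSetOp_mainOpO φ α)]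

theorem sub_smul_mainOpO_resolventOp_apply (φ : SchurClass U Y) (α : RHP) (x : Ho φ) (μ : RHP) :
    ((α : ℂ) - μ) • mainOpO φ (resolventOp (mainOpO φ) α x) μ =
      (μ : ℂ) • x μ - (α : ℂ) • x α := by
  rw [apply_resolventOp (mem_resolventSetOp_mainOpO φ α), RKHS.coe_sub, RKHS.coe_smul,
    Pi.sub_apply, Pi.smul_apply, smul_sub, smul_comm, sub_smul_resolventOp_apply]
  module

theorem obsOpO_resolventOp (φ : SchurClass U Y) (α : RHP) (x : Ho φ) :
    obsOpO φ (resolventOp (mainOpO φ) α x) = x α := by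
  rw [obsOpO_eq_shiftOp_apply φ α, shiftOp_resolventOp (mem_resolventSetOp_mainOpO φ α)]

theorem isClosed_mainOpO (φ : SchurClass U Y) : (mainOpO φ).IsClosed := by
  let α : RHP := ⟨1, by simp⟩
  obtain ⟨Q, hQ, -⟩ := exists_diffQuot φ α
  refine isClosed_of_continuous_resolventOp (mem_resolventSetOp_mainOpO φ α)
    (Q.continuous.congr fun x => Ho.ext_of_sub_smul_eq α fun μ => ?_)
  rw [hQ, sub_smul_resolventOp_apply]

theorem re_inner_mainOpO_nonpos (φ : SchurClass U Y) (z : (mainOpO φ).domain) :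
    (inner ℂ (mainOpO φ z) (z : Ho φ)).re ≤ 0 := by
  let α : RHP := ⟨1, by simp⟩
  obtain ⟨Q, hQ, hQ_norm⟩ := exists_diffQuot φ α
  have hz : Q (shiftOp (mainOpO φ) α z) = z :=
    Ho.ext_of_sub_smul_eq α fun μ => by rw [hQ, sub_smul_apply_eq_shiftOp_sub]
  have h := hQ_norm (shiftOp (mainOpO φ) α z)
  rw [hz, ← sq_le_sq₀ (norm_nonneg _) (norm_nonneg _), norm_shiftOp_sq (mainOpO φ)] at h
  simp only [α, Complex.one_re] at h
  linarith

theorem dense_domain_mainOpO (φ : SchurClass U Y) : Dense ((mainOpO φ).domain : Set (Ho φ)) :=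
  dense_domain_of_dissipative _ (re_inner_mainOpO_nonpos φ) (α := 1) (by simp)
    (mem_resolventSetOp_mainOpO φ ⟨1, by simp⟩).surjective

theorem schurQuot_mem_graph {φ : SchurClass U Y} {α : RHP} {g : Ho φ} {u : U}
    (hg : ∀ μ : RHP, ((α : ℂ) - μ) • g μ = φ μ u - φ α u) :
    (WithLp.toLp 2 (g, u), WithLp.toLp 2 ((α : ℂ) • g, φ α u)) ∈ (observableModel φ).graph := by
  refine mem_graph_observableModel_iff.mpr fun μ => ?_
  simpa only [sub_smul, sub_eq_sub_iff_add_eq_add, add_comm (φ μ u), WithLp.toLp_fst,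
    WithLp.toLp_snd, RKHS.coe_smul, Pi.smul_apply] using hg μ

end DeBrangesRovnyak

theorem theorem5p3 {U Y : Type*}
    [NormedAddCommGroup U] [InnerProductSpace ℂ U] [CompleteSpace U]
    [NormedAddCommGroup Y] [InnerProductSpace ℂ Y] [CompleteSpace Y]
    (φ : SchurClass U Y) :
    -- the domain of `A_o`
    (∀ x : Ho φ, x ∈ (mainOpO φ).domain ↔
      ∃ y : Y, ∃ z : Ho φ, ∀ μ : RHP, z μ = (μ : ℂ) • x μ - y) ∧
    -- the action of `A_o` and `C_o`
    (∀ x : (mainOpO φ).domain, ∃ L : Y,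
      Tendsto (fun η : RHP => (η : ℂ) • (x : Ho φ) η) reAtTop (𝓝 L) ∧
      (∀ μ : RHP, (mainOpO φ x) μ = (μ : ℂ) • (x : Ho φ) μ - L) ∧
      obsOpO φ x = L) ∧
    -- `A_o` is closed, and its resolvent set contains the right half-plane
    (mainOpO φ).IsClosed ∧
    (∀ α : RHP, (α : ℂ) ∈ resolventSetOp (mainOpO φ)) ∧
    -- the resolvent of `A_o`, and its products with `A_o` and `C_o`
    (∀ (α : RHP) (x : Ho φ),
      IsDiffQuot (fun μ : RHP => x μ) α
        (fun μ : RHP => (resolventOp (mainOpO φ) α x : Ho φ) μ) ∧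
      IsDiffQuot (fun μ : RHP => (μ : ℂ) • x μ) α
        (fun μ : RHP => (mainOpO φ (resolventOp (mainOpO φ) α x)) μ) ∧
      obsOpO φ (resolventOp (mainOpO φ) α x) = x α) ∧
    -- for every rigging parameter `β`, the extension `T = A_o|` and the control operator `B = B_o`
    -- exist and are unique, and `(α - A_o|)⁻¹ B_o` is given by the difference quotient of `φ`
    (∀ β : RHP, ∃ T : Ho φ →L[ℂ] RiggedSpace (mainOpO φ) β,
      (∀ T' : Ho φ →L[ℂ] RiggedSpace (mainOpO φ) β,
        IsRiggedExtension (mainOpO φ) β T' ↔ T' = T) ∧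
      ∃ B : U →L[ℂ] RiggedSpace (mainOpO φ) β,
        (∀ B' : U →L[ℂ] RiggedSpace (mainOpO φ) β,
          IsControlOperator (observableModel φ) β T B' ↔ B' = B) ∧
        ∀ α : RHP,
          Function.Bijective
            (fun x : Ho φ => (α : ℂ) • riggedIncl (mainOpO φ) β x - T x) ∧
          ∀ u : U, ∃ g : Ho φ,
            (α : ℂ) • riggedIncl (mainOpO φ) β g - T g = B u ∧
            IsDiffQuot (fun μ : RHP => φ μ u) α (fun μ : RHP => g μ)) := by
  have hρ := mem_resolventSetOp_mainOpO φ
  have hA := isClosed_mainOpO φ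
  have hd := dense_domain_mainOpO φ
  refine ⟨fun x => mem_domain_mainOpO_iff,
    fun x => ⟨obsOpO φ x, tendsto_smul_apply_reAtTop φ x, mainOpO_apply φ x, rfl⟩, hA, hρ,
    fun α x => ⟨Ho.isDiffQuot (sub_smul_resolventOp_apply φ α x),
      Ho.isDiffQuot (sub_smul_mainOpO_resolventOp_apply φ α x), obsOpO_resolventOp φ α x⟩,
    fun β => ⟨riggedExtension hA hd (hρ β), fun T => isRiggedExtension_iff hA hd (hρ β), ?_⟩⟩
  choose E hE using exists_schurQuot φ
  have hB {B} := isControlOperator_iff hA hd (hρ β) (B := B) fun u => schurQuot_mem_graph (hE β u)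
  refine ⟨_, fun _ => hB, fun α => ⟨bijective_smul_riggedIncl_sub hA hd (hρ β) (hρ α), fun u =>
    ⟨E α u, (hB.mpr rfl).smul_riggedIncl_sub (schurQuot_mem_graph (hE α u)),
      Ho.isDiffQuot (hE α u)⟩⟩⟩
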